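/- Let $(\Omega,d,\mu)$ be a metric space with a Borel measure such that $0<\mu(B(x,r))<\infty$ and $\mu(\{x\})=0$ for all $x\in\Omega$, $r>0$. Suppose that it is an RD-space with indices $(k,n)$, $0<k\le n$: there are constants $0<C_1\le 1\le C_2$ with $$C_1\lambda^k\mu(B(x,r))\le \mu(B(x,\lambda r))\le C_2\lambda^n\mu(B(x,r))\qquad (x\in\Omega,\ r>0,\ \lambda\ge 1),$$ and that it is non-collapsing: $\inf_{x\in\Omega}\mu(B(x,1))>0$. For measurable $f:\Omega\to\mathbb R$ put $f^*(s)=\inf\{\tau\ge 0:\mu\{|f|>\tau\}\le s\}$, $f^{**}(t)=\frac1t\int_0^t f^*(s)\,ds$ and $O(f,t)=f^{**}(t)-f^*(t)$. A nonnegative measurable function $g$ is a $1$-gradient of $f$, $g\in D(f)$, if $|f(x)-f(y)|\le d(x,y)(g(x)+g(y))$ for all $x,y$ outside a $\mu$-null set. For a rearrangement invariant Banach function space $Y$ with the Fatou property over $(\Omega,\mu)$ (including $Y=L^1+L^\infty$), the homogeneous Haj\l asz--Sobolev space $\dot M^{1,Y}$ consists of the measurable $f\in L^1+L^\infty$ with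 $\|f\|_{\dot M^{1,Y}}=\inf_{g\in D(f)}\|g\|_Y<\infty$. For such a space $X$ let $\phi_X(t)=\|\chi_F\|_X$, where $\mu(F)=t$, be its fundamental function, and let $$K(f,s)=K(f,s;X,\dot M^{1,X})=\inf\{\|f_0\|_X+s\|f_1\|_{\dot M^{1,X}}: f=f_0+f_1,\ f_0\in X,\ f_1\in\dot M^{1,X}\}$$ (with $K(f,s)=\infty$ if there is no such decomposition). Let $R(t)=\max(t^{1/n},t^{1/k})$. Then there is a constant $C$, depending only on $(\Omega,d,\mu)$ and $(k,n)$, such that for every rearrangement invariant space $X$ on $\Omega$, every $f\in \dot M^{1,L^1+L^\infty}$ and every $t>0$, $$O(f,t)=f^{**}(t)-f^*(t)\le C\,\frac{K(f,R(t))}{\phi_X(t)}.$$ -/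

import Mathlib

open MeasureTheory
open scoped ENNReal NNReal

noncomputable section

namespace HajlaszBesov

variable {Ω : Type*} [MeasurableSpace Ω]

/-! ### Metric measure spaces, RD-spaces -/

/-- A metric measure space in the sense used here: the Borel measure `μ` gives every ball a
positive finite mass and has no point masses. -/
structure IsMetricMeasure [MetricSpace Ω] (μ : Measure Ω) : Prop where
  ball_pos : ∀ (x : Ω) (r : ℝ), 0 < r → 0 < μ (Metric.ball x r)
  ball_lt_top : ∀ (x : Ω) (r : ℝ), 0 < r → μ (Metric.ball x r) < ∞
  singleton_eq_zero : ∀ x : Ω, μ {x} = 0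

/-- `(Ω, d, μ)` is an RD-space with indices `(k, n)`. -/
structure IsRDSpace [MetricSpace Ω] (μ : Measure Ω) (k n : ℝ) : Prop extends
    IsMetricMeasure μ where
  k_pos : 0 < k
  k_le_n : k ≤ n
  growth : ∃ C₁ C₂ : ℝ, 0 < C₁ ∧ C₁ ≤ 1 ∧ 1 ≤ C₂ ∧
    ∀ (x : Ω) (r l : ℝ), 0 < r → 1 ≤ l →
      ENNReal.ofReal (C₁ * l ^ k) * μ (Metric.ball x r) ≤ μ (Metric.ball x (l * r)) ∧
      μ (Metric.ball x (l * r)) ≤ ENNReal.ofReal (C₂ * l ^ n) * μ (Metric.ball x r)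

/-- The non-collapsing property: the unit balls have measure bounded away from zero. -/
def NonCollapsing [MetricSpace Ω] (μ : Measure Ω) : Prop :=
  0 < ⨅ x : Ω, μ (Metric.ball x 1)

/-! ### Rearrangements -/

/-- The decreasing rearrangement `u*(s) = inf {τ ≥ 0 : μ {u > τ} ≤ s}` of a `[0, ∞]`-valued
function (`∞` if no finite `τ` qualifies). -/
def rearr (μ : Measure Ω) (u : Ω → ℝ≥0∞) (s : ℝ) : ℝ≥0∞ :=
  sInf {τ : ℝ≥0∞ | μ {x | τ < u x} ≤ ENNReal.ofReal s}

/-- The decreasing rearrangement `f*` of a real function `f`, that is, of `|f|`. -/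
def decRearr (μ : Measure Ω) (f : Ω → ℝ) (s : ℝ) : ℝ≥0∞ :=
  rearr μ (fun x => ‖f x‖ₑ) s

/-- The maximal function `f**(t) = (1/t) ∫_0^t f*(s) ds`. -/
def maxRearr (μ : Measure Ω) (f : Ω → ℝ) (t : ℝ) : ℝ≥0∞ :=
  (∫⁻ s in Set.Ioo 0 t, decRearr μ f s) / ENNReal.ofReal t

/-- The oscillation `O(f, t) = f**(t) - f*(t)`. The subtraction is an honest one:
see `decRearr_le_maxRearr` and `decRearr_ne_top` below. -/
def oscillation (μ : Measure Ω) (f : Ω → ℝ) (t : ℝ) : ℝ≥0∞ :=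
  maxRearr μ f t - decRearr μ f t

/-! ### Rearrangement invariant spaces -/

/-- A rearrangement invariant Banach function space with the Fatou property over `(Ω, μ)`, given
by its function norm `ρ` on the nonnegative (a.e.-)measurable functions; the space consists of the
measurable `f` with `ρ |f| < ∞`. -/
structure RISpace (μ : Measure Ω) where
  ρ : (Ω → ℝ≥0∞) → ℝ≥0∞
  eq_zero_iff : ∀ u, AEMeasurable u μ → (ρ u = 0 ↔ u =ᵐ[μ] 0)
  smul_eq : ∀ (c : ℝ≥0) (u), AEMeasurable u μ → ρ (fun x => c * u x) = c * ρ u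
  add_le : ∀ u v, AEMeasurable u μ → AEMeasurable v μ → ρ (fun x => u x + v x) ≤ ρ u + ρ v
  mono : ∀ u v, AEMeasurable u μ → AEMeasurable v μ → u ≤ᵐ[μ] v → ρ u ≤ ρ v
  fatou : ∀ u : ℕ → Ω → ℝ≥0∞, (∀ i, AEMeasurable (u i) μ) →
    (∀ᵐ x ∂μ, Monotone fun i => u i x) → ρ (fun x => ⨆ i, u i x) = ⨆ i, ρ (u i)
  indicator_lt_top : ∀ F, MeasurableSet F → μ F < ∞ → ρ (F.indicator fun _ => 1) < ∞
  lintegral_le : ∀ F, MeasurableSet F → μ F < ∞ →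
    ∃ C : ℝ≥0, ∀ u, AEMeasurable u μ → ∫⁻ x in F, u x ∂μ ≤ C * ρ u
  rearr_invariant : ∀ u v, AEMeasurable u μ → AEMeasurable v μ →
    (∀ᵐ t ∂(volume.restrict (Set.Ioi (0 : ℝ))), rearr μ u t ≤ rearr μ v t) → ρ u ≤ ρ v

namespace RISpace

variable {μ : Measure Ω} (X : RISpace μ)

/-- The norm `‖f‖_X` (with value `∞` if `f ∉ X`). -/
def norm (f : Ω → ℝ) : ℝ≥0∞ := X.ρ fun x => ‖f x‖ₑ

/-- `f ∈ X`. -/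
def Mem (f : Ω → ℝ) : Prop := AEMeasurable f μ ∧ X.norm f < ∞

/-- The fundamental function `φ_X(t) = ‖χ_F‖_X`, where `μ F = t`. All such `F` give the same
value (`fundamental_eq` below), so the infimum only serves to pick it. -/
def fundamental (t : ℝ) : ℝ≥0∞ :=
  ⨅ (F : Set Ω) (_ : MeasurableSet F) (_ : μ F = ENNReal.ofReal t), X.ρ (F.indicator fun _ => 1)

end RISpace

/-- The norm of `L¹ + L^∞` (with value `∞` off that space). -/
def sumNorm (μ : Measure Ω) (f : Ω → ℝ) : ℝ≥0∞ :=
  ⨅ (g : Ω → ℝ) (h : Ω → ℝ) (_ : AEMeasurable g μ) (_ : AEMeasurable h μ)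
    (_ : f =ᵐ[μ] g + h), eLpNorm g 1 μ + eLpNorm h ∞ μ

/-- `f ∈ L¹ + L^∞`. -/
def MemSum (μ : Measure Ω) (f : Ω → ℝ) : Prop := AEMeasurable f μ ∧ sumNorm μ f < ∞

/-! ### Hajłasz–Sobolev spaces and the K-functional -/

/-- `g ∈ D(f)`: `g` is a `1`-gradient of `f`, i.e. `g` is nonnegative, measurable and
`|f(x) - f(y)| ≤ d(x,y) (g(x) + g(y))` for all `x, y` outside a set of measure zero. -/
def IsGradient [MetricSpace Ω] (μ : Measure Ω) (f g : Ω → ℝ) : Prop :=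
  AEMeasurable g μ ∧ (∀ x, 0 ≤ g x) ∧
    ∃ N : Set Ω, μ N = 0 ∧ ∀ x ∉ N, ∀ y ∉ N, |f x - f y| ≤ dist x y * (g x + g y)

/-- `inf {‖g‖ : g ∈ D(f)}`, for a given norm `‖·‖` on functions. -/
def hajlaszNorm [MetricSpace Ω] (μ : Measure Ω) (nrm : (Ω → ℝ) → ℝ≥0∞) (f : Ω → ℝ) : ℝ≥0∞ :=
  ⨅ (g : Ω → ℝ) (_ : IsGradient μ f g), nrm g

/-- `f` lies in the homogeneous Hajłasz–Sobolev space over the space with norm `nrm`. -/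
def MemHajlasz [MetricSpace Ω] (μ : Measure Ω) (nrm : (Ω → ℝ) → ℝ≥0∞) (f : Ω → ℝ) : Prop :=
  MemSum μ f ∧ hajlaszNorm μ nrm f < ∞

/-- Peetre's K-functional `K(f, s)` of `X` and the homogeneous Hajłasz–Sobolev space over `X`
(with value `∞` if `f` is not in the sum of the two spaces). -/
def peetreK [MetricSpace Ω] {μ : Measure Ω} (X : RISpace μ) (f : Ω → ℝ) (s : ℝ) : ℝ≥0∞ :=
  ⨅ (f₀ : Ω → ℝ) (f₁ : Ω → ℝ) (_ : X.Mem f₀) (_ : MemHajlasz μ X.norm f₁)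
    (_ : f =ᵐ[μ] f₀ + f₁), X.norm f₀ + ENNReal.ofReal s * hajlaszNorm μ X.norm f₁

/-! ### Consistency of the definitions -/

theorem RISpace.fundamental_eq {μ : Measure Ω} (X : RISpace μ) {F : Set Ω} {t : ℝ}
    (hF : MeasurableSet F) (ht : μ F = ENNReal.ofReal t) :
    X.fundamental t = X.ρ (F.indicator fun _ => 1) := by
  have key : ∀ G H : Set Ω, MeasurableSet G → MeasurableSet H → μ G = μ H →
      X.ρ (G.indicator fun _ => 1) ≤ X.ρ (H.indicator fun _ => 1) := by
    intro G H hG hH hGH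
    refine X.rearr_invariant _ _ (measurable_const.indicator hG).aemeasurable
      (measurable_const.indicator hH).aemeasurable (Filter.Eventually.of_forall fun s => le_of_eq ?_)
    have aux : ∀ (S : Set Ω) (τ : ℝ≥0∞),
        {x | τ < S.indicator (fun _ => (1 : ℝ≥0∞)) x} = if τ < 1 then S else ∅ := by
      intro S τ
      ext x
      by_cases hx : x ∈ S <;> by_cases hτ : τ < 1 <;> simp [hx, hτ]
    unfold rearr
    congr 1
    ext τ
    simp only [Set.mem_ofPred_eq, aux]
    split_ifs <;> simp [hGH]
  refine le_antisymm (iInf_le_of_le F (iInf_le_of_le hF (iInf_le_of_le ht le_rfl))) ?_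
  exact le_iInf fun G => le_iInf fun hG => le_iInf fun hGt => key F G hF hG (ht.trans hGt.symm)

theorem decRearr_antitone (μ : Measure Ω) (f : Ω → ℝ) {s t : ℝ} (h : s ≤ t) :
    decRearr μ f t ≤ decRearr μ f s :=
  sInf_le_sInf fun _ hτ => le_trans hτ (ENNReal.ofReal_le_ofReal h)

theorem decRearr_le_maxRearr (μ : Measure Ω) (f : Ω → ℝ) {t : ℝ} (ht : 0 < t) :
    decRearr μ f t ≤ maxRearr μ f t := by
  unfold maxRearr
  rw [ENNReal.le_div_iff_mul_le (Or.inl (by simpa using ht)) (Or.inl ENNReal.ofReal_ne_top)]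
  calc decRearr μ f t * ENNReal.ofReal t
      = ∫⁻ _ in Set.Ioo 0 t, decRearr μ f t := by simp
    _ ≤ ∫⁻ s in Set.Ioo 0 t, decRearr μ f s :=
        setLIntegral_mono' measurableSet_Ioo fun s hs => decRearr_antitone μ f hs.2.le

theorem decRearr_ne_top {μ : Measure Ω} {f : Ω → ℝ} (hf : MemSum μ f) {t : ℝ} (ht : 0 < t) :
    decRearr μ f t ≠ ∞ := by
  obtain ⟨-, hf⟩ := hf
  simp only [sumNorm, iInf_lt_iff] at hf
  obtain ⟨g, h, hg, hh, hfgh, hlt⟩ := hf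
  obtain ⟨h1, h2⟩ := ENNReal.add_lt_top.1 hlt
  rw [eLpNorm_one_eq_lintegral_enorm] at h1
  have ht' : ENNReal.ofReal t ≠ 0 := by simpa using ht
  set a := (∫⁻ x, ‖g x‖ₑ ∂μ) / ENNReal.ofReal t with ha
  have hafin : a ≠ ∞ := ENNReal.div_ne_top h1.ne ht'
  have hmem : decRearr μ f t ≤ (a + 1) + eLpNorm h ∞ μ := by
    refine sInf_le ?_
    have hsub : μ {x | (a + 1) + eLpNorm h ∞ μ < ‖f x‖ₑ} ≤ μ {x | a + 1 ≤ ‖g x‖ₑ} := by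
      refine measure_mono_ae ?_
      have hb : ∀ᵐ x ∂μ, ‖h x‖ₑ ≤ eLpNorm h ∞ μ := by
        rw [eLpNorm_exponent_top]
        exact ae_le_eLpNormEssSup
      filter_upwards [hfgh, hb] with x hx hbx hlt
      have hlt' : (a + 1) + eLpNorm h ∞ μ < ‖f x‖ₑ := hlt
      change a + 1 ≤ ‖g x‖ₑ
      by_contra hcon
      have : ‖f x‖ₑ ≤ (a + 1) + eLpNorm h ∞ μ := by
        rw [hx]
        exact (enorm_add_le _ _).trans (add_le_add (not_le.1 hcon).le hbx)
      exact absurd hlt' (not_lt.2 this)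
    refine hsub.trans ((meas_ge_le_lintegral_div hg.enorm (by simp)
      (ENNReal.add_ne_top.2 ⟨hafin, ENNReal.one_ne_top⟩)).trans ?_)
    rw [ENNReal.div_le_iff (by simp) (ENNReal.add_ne_top.2 ⟨hafin, ENNReal.one_ne_top⟩)]
    calc (∫⁻ x, ‖g x‖ₑ ∂μ) = ENNReal.ofReal t * a := by
          rw [ha, ENNReal.mul_div_cancel ht' ENNReal.ofReal_ne_top]
      _ ≤ ENNReal.ofReal t * (a + 1) := by gcongr; exact le_self_add
  exact ne_top_of_le_ne_top
    (ENNReal.add_ne_top.2 ⟨ENNReal.add_ne_top.2 ⟨hafin, ENNReal.one_ne_top⟩, h2.ne⟩) hmem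

end HajlaszBesov

end

noncomputable section

namespace HajlaszBesov

/-! ### Nonatomic measures on separable metric spaces -/

/-! Fix `f = f₀ + f₁`, a gradient `g` of `f₁`, and `h = |f₀| + r g`, where `r = A R(t)` is so large
that every ball of radius `r` has measure above `2t`. The sets `{|f| > f*(t)}` and `{h > h*(t)}`
have measure at most `t` each, so together they cannot cover `B(x, r)`. Hence almost every `x` has
some `y` within distance `r` with `|f(y)| ≤ f*(t)` and `h(y) ≤ h*(t)`, and the gradient inequality
gives `|f(x)| ≤ f*(t) + h*(t) + h(x)`. Rearranging and averaging over `(0, t)` yields `O(f,t) ≤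
h*(t) + h**(t) ≤ 2 h**(t)` (`oscillation_mul_le`). The radius comes from non-collapsing together
with both growth bounds (`IsRDSpace.exists_lt_measure_ball`).

It remains to see that `h**(t) φ_X(t) ≤ ‖h‖_X` (`RISpace.lintegral_rearr_mul_fundamental_le`). Take
`N` disjoint sets of measure `t/N` and place on them, in any cyclic order, the values of `h*` at
multiples of `t/N`. Each such step function is dominated by `h` in distribution, so its norm is at
most `‖h‖_X`. The sum of all `N` cyclic shifts is a constant multiple of the indicator of a set of
measure `t`, and the constants are Riemann sums for `∫ h*`. The disjoint sets exist because the
space is second countable and has no point masses. Since `‖h‖_X ≤ A (‖f₀‖_X + R(t) ‖g‖_X)`, taking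
infima over `g` and over the decomposition gives the K-functional. -/

theorem exists_measure_Iic_eq (P : Measure ℝ) [IsProbabilityMeasure P] [NullSingletonClass P] {s : ℝ}
    (h0 : 0 < s) (h1 : s < 1) : ∃ x, P (Set.Iic x) = ENNReal.ofReal s := by
  have hcont : Continuous (ProbabilityTheory.cdf P) := by
    refine continuous_iff_continuousAt.2 fun x => ?_
    -- The jump of the distribution function at `x` is the mass of `{x}`, which is zero.
    rw [(ProbabilityTheory.monotone_cdf P).continuousAt_iff_leftLim_eq_rightLim,
      StieltjesFunction.rightLim_eq]
    have h := (ProbabilityTheory.cdf P).measure_singleton x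
    rw [ProbabilityTheory.measure_cdf, measure_singleton, eq_comm, ENNReal.ofReal_eq_zero] at h
    exact le_antisymm ((ProbabilityTheory.monotone_cdf P).leftLim_le le_rfl) (by linarith)
  obtain ⟨a, ha⟩ := ((ProbabilityTheory.tendsto_cdf_atBot P).eventually_lt_const h0).exists
  obtain ⟨b, hb⟩ := ((ProbabilityTheory.tendsto_cdf_atTop P).eventually_const_lt h1).exists
  obtain ⟨x, hx⟩ := mem_range_of_exists_le_of_exists_ge hcont ⟨a, ha.le⟩ ⟨b, hb.le⟩
  exact ⟨x, by rw [← ProbabilityTheory.ofReal_cdf, hx]⟩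

/-- In a countably separated space, a measure without point masses restricted to a set of finite
measure takes all intermediate values along an increasing family of sets. -/
theorem exists_monotoneOn_measure_eq {Ω : Type*} [MeasurableSpace Ω]
    [MeasurableSpace.CountablySeparated Ω] {μ : Measure Ω} (h0 : ∀ x, μ {x} = 0) {B : Set Ω}
    (hB : MeasurableSet B) (hBtop : μ B ≠ ∞) {t : ℝ} (ht : ENNReal.ofReal t < μ B) :
    ∃ F : ℝ → Set Ω, (∀ s, MeasurableSet (F s)) ∧ MonotoneOn F (Set.Icc 0 t) ∧
      ∀ s ∈ Set.Icc 0 t, μ (F s) = ENNReal.ofReal s := by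
  obtain ⟨e₀, he₀, hinj₀⟩ := MeasurableSpace.measurable_injection_nat_bool_of_countablySeparated Ω
  -- An injective measurable map to `ℝ` pushes the normalized measure on `B` to one without point
  -- masses; preimages of half-lines then have every intermediate measure.
  set e : Ω → ℝ := embeddingReal (ℕ → Bool) ∘ e₀ with he_def
  have he : Measurable e := (measurable_embeddingReal _).comp he₀
  have hinj : Function.Injective e :=
    (measurableEmbedding_embeddingReal (ℕ → Bool)).injective.comp hinj₀
  have hB0 : μ B ≠ 0 := (pos_of_gt ht).ne'
  have : IsProbabilityMeasure (ProbabilityTheory.cond μ B) :=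
    ProbabilityTheory.cond_isProbabilityMeasure_of_finite hB0 hBtop
  set P : Measure ℝ := (ProbabilityTheory.cond μ B).map e with hP
  have : IsProbabilityMeasure P := Measure.isProbabilityMeasure_map he.aemeasurable
  have : NullSingletonClass P := by
    refine ⟨fun x => ?_⟩
    rw [hP, Measure.map_apply he (measurableSet_singleton x), ProbabilityTheory.cond_apply hB]
    have hsub : (e ⁻¹' {x}).Subsingleton := Set.subsingleton_singleton.preimage hinj
    have : μ (B ∩ e ⁻¹' {x}) = 0 := by
      refine measure_mono_null Set.inter_subset_right ?_
      rcases hsub.eq_empty_or_singleton with h | ⟨y, h⟩ <;> simp [h, h0]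
    simp [this]
  have hb : 0 < (μ B).toReal := ENNReal.toReal_pos hB0 hBtop
  have key : ∀ s : ℝ, ∃ x : ℝ, 0 < s → s ≤ t → μ (B ∩ e ⁻¹' Set.Iic x) = ENNReal.ofReal s := by
    intro s
    by_cases hs : 0 < s ∧ s ≤ t
    swap
    · exact ⟨0, fun h h' => absurd ⟨h, h'⟩ hs⟩
    have hlt : s < (μ B).toReal :=
      (ENNReal.ofReal_lt_iff_lt_toReal hs.1.le hBtop).1
        ((ENNReal.ofReal_le_ofReal hs.2).trans_lt ht)
    obtain ⟨x, hx⟩ := exists_measure_Iic_eq P (div_pos hs.1 hb) ((div_lt_one hb).2 hlt)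
    refine ⟨x, fun _ _ => ?_⟩
    rw [hP, Measure.map_apply he measurableSet_Iic, ProbabilityTheory.cond_apply hB,
      ENNReal.ofReal_div_of_pos hb, ENNReal.ofReal_toReal hBtop, mul_comm,
      ← div_eq_mul_inv] at hx
    have := congrArg (· * μ B) hx
    simpa [ENNReal.div_mul_cancel hB0 hBtop] using this
  choose x hx using key
  refine ⟨fun s => if 0 < s then B ∩ e ⁻¹' Set.Iic (x s) else ∅, fun s => ?_, ?_, ?_⟩
  · dsimp only
    split_ifs
    exacts [hB.inter (he measurableSet_Iic), MeasurableSet.empty]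
  · intro s hs s' hs' hss
    rcases hs.1.eq_or_lt with h | h
    · simp [← h]
    · have h' := h.trans_le hss
      simp only [h, h', if_true]
      -- The chosen cut points need not be monotone in `s`. If they are in the wrong order, the
      -- reversed inclusion forces `s = s'`.
      rcases le_total (x s) (x s') with hle | hle
      · exact Set.inter_subset_inter_right _ (Set.preimage_mono (Set.Iic_subset_Iic.2 hle))
      · have hsub : B ∩ e ⁻¹' Set.Iic (x s') ⊆ B ∩ e ⁻¹' Set.Iic (x s) :=
          Set.inter_subset_inter_right _ (Set.preimage_mono (Set.Iic_subset_Iic.2 hle))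
        have := measure_mono (μ := μ) hsub
        rw [hx s h hs.2, hx s' h' hs'.2, ENNReal.ofReal_le_ofReal_iff h.le] at this
        rw [le_antisymm hss this]
  · intro s hs
    rcases hs.1.eq_or_lt with h | h
    · simp [← h]
    · simp only [h, if_true]
      exact hx s h hs.2

/-- Under the same hypotheses there are `N` disjoint sets of equal measure `t / N`. -/
theorem exists_equipartition {Ω : Type*} [MeasurableSpace Ω]
    [MeasurableSpace.CountablySeparated Ω] {μ : Measure Ω} (h0 : ∀ x, μ {x} = 0) {B : Set Ω}
    (hB : MeasurableSet B) (hBtop : μ B ≠ ∞) {t : ℝ} (ht0 : 0 < t)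
    (ht : ENNReal.ofReal t < μ B) (N : ℕ) [NeZero N] :
    ∃ E : Fin N → Set Ω, (∀ j, MeasurableSet (E j)) ∧ Pairwise (Function.onFun Disjoint E) ∧
      (∀ j, μ (E j) = ENNReal.ofReal (t / N)) ∧ μ (⋃ j, E j) = ENNReal.ofReal t := by
  obtain ⟨F, hFm, hFmono, hF⟩ := exists_monotoneOn_measure_eq h0 hB hBtop ht
  have hN : (0 : ℝ) < N := by exact_mod_cast Nat.pos_of_ne_zero (NeZero.ne N)
  have hmem : ∀ j : ℕ, j ≤ N → (j : ℝ) * (t / N) ∈ Set.Icc 0 t := by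
    intro j hj
    refine ⟨by positivity, ?_⟩
    calc (j : ℝ) * (t / N) ≤ N * (t / N) := by gcongr
      _ = t := by field_simp
  have hmono : ∀ i j : ℕ, i ≤ j → j ≤ N → F (i * (t / N)) ⊆ F (j * (t / N)) := fun i j hij hj =>
    hFmono (hmem i (hij.trans hj)) (hmem j hj) (by gcongr)
  set E : Fin N → Set Ω := fun j => F ((j + 1 : ℕ) * (t / N)) \ F ((j : ℕ) * (t / N)) with hE
  have hEm : ∀ j, MeasurableSet (E j) := fun j => (hFm _).diff (hFm _)
  have hdisj : Pairwise (Function.onFun Disjoint E) := by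
    have aux : ∀ i j : Fin N, i < j → Disjoint (E i) (E j) := fun i j hij =>
      Set.disjoint_left.2 fun x hxi hxj => hxj.2 (hmono _ _ hij j.2.le hxi.1)
    intro i j hij
    rcases lt_or_gt_of_ne hij with h | h
    exacts [aux i j h, (aux j i h).symm]
  have hmeas : ∀ j, μ (E j) = ENNReal.ofReal (t / N) := by
    intro j
    rw [hE]
    dsimp only
    rw [measure_sdiff (hmono _ _ (Nat.le_succ _) j.2) (hFm _).nullMeasurableSet
      (by rw [hF _ (hmem _ j.2.le)]; exact ENNReal.ofReal_ne_top), hF _ (hmem _ j.2.le),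
      hF _ (hmem _ j.2), ← ENNReal.ofReal_sub _ (hmem _ j.2.le).1]
    congr 1
    push_cast
    ring
  refine ⟨E, hEm, hdisj, hmeas, ?_⟩
  rw [measure_iUnion hdisj hEm, tsum_fintype]
  simp only [hmeas, Finset.sum_const, Finset.card_univ, Fintype.card_fin, nsmul_eq_mul]
  rw [← ENNReal.ofReal_natCast, ← ENNReal.ofReal_mul hN.le]
  congr 1
  field_simp

/-- A metric space carrying a measure for which balls have positive finite measure is second
countable. -/
theorem IsMetricMeasure.secondCountableTopology {Ω : Type*} [MetricSpace Ω] [MeasurableSpace Ω]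
    [BorelSpace Ω] {μ : Measure Ω} (h : IsMetricMeasure μ) : SecondCountableTopology Ω := by
  rcases isEmpty_or_nonempty Ω with hΩ | ⟨⟨x₀⟩⟩
  · infer_instance
  have : SigmaFinite μ := by
    refine ⟨⟨⟨fun i : ℕ => Metric.ball x₀ (i + 1), fun _ => trivial,
      fun i => h.ball_lt_top _ _ (by positivity), ?_⟩⟩⟩
    refine Set.eq_univ_of_forall fun x => ?_
    obtain ⟨i, hi⟩ := exists_nat_gt (dist x x₀)
    exact Set.mem_iUnion.2 ⟨i, by rw [Metric.mem_ball]; linarith⟩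
  refine Metric.secondCountable_of_almost_dense_set fun ε hε => ?_
  -- A maximal `ε`-separated set is `ε`-dense, and it is countable: the balls of radius `ε / 2`
  -- about its points are disjoint and of positive measure, while `μ` is σ-finite.
  obtain ⟨S, hS⟩ := zorn_subset {S : Set Ω | S.Pairwise fun x y => ε ≤ dist x y} (by
    intro c hc hchain
    refine ⟨⋃₀ c, ?_, fun s hs => Set.subset_sUnion_of_mem hs⟩
    exact (Set.pairwise_sUnion hchain.directedOn).2 hc)
  refine ⟨S, ?_, fun x => ?_⟩
  · have hc := Measure.countable_meas_pos_of_disjoint_iUnion (μ := μ)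
      (As := fun x : S => Metric.ball (x : Ω) (ε / 2)) (fun _ => Metric.isOpen_ball.measurableSet)
      (fun x y hxy => Metric.ball_disjoint_ball (by
        have := hS.prop x.2 y.2 (fun h => hxy (Subtype.ext h))
        simpa using this))
    have huniv : {x : S | 0 < μ (Metric.ball (x : Ω) (ε / 2))} = Set.univ :=
      Set.eq_univ_of_forall fun x => h.ball_pos _ _ (by positivity)
    rw [huniv, Set.countable_univ_iff] at hc
    exact Set.countable_coe_iff.1 hc
  · by_contra! hcon
    have hxS : x ∈ S := by
      refine hS.le_of_ge (y := insert x S) ?_ (Set.subset_insert _ _) (Set.mem_insert _ _)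
      refine hS.prop.insert fun y hy _ => ⟨(hcon y hy).le, ?_⟩
      rw [dist_comm]
      exact (hcon y hy).le
    have := hcon x hxS
    rw [dist_self] at this
    linarith

/-! ### Decreasing rearrangements -/

section Rearrangement

variable {Ω : Type*} [MeasurableSpace Ω] {μ : Measure Ω}

theorem rearr_antitone (μ : Measure Ω) (u : Ω → ℝ≥0∞) : Antitone (rearr μ u) := fun _ _ h =>
  sInf_le_sInf fun _ hτ => le_trans hτ (ENNReal.ofReal_le_ofReal h)

/-- The infimum defining `u*(s)` is attained: as levels decrease to it, their superlevel sets
increase to `{u > u*(s)}`, and measure is continuous from below. -/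
theorem measure_rearr_lt_le (μ : Measure Ω) (u : Ω → ℝ≥0∞) (s : ℝ) :
    μ {x | rearr μ u s < u x} ≤ ENNReal.ofReal s := by
  set S : Set ℝ≥0∞ := {τ : ℝ≥0∞ | μ {x | τ < u x} ≤ ENNReal.ofReal s} with hS
  have hne : S.Nonempty := ⟨∞, by simp [hS]⟩
  obtain ⟨c, hanti, htend, hmem⟩ := exists_seq_tendsto_sInf hne (OrderBot.bddBelow S)
  have hsub : {x | rearr μ u s < u x} ⊆ ⋃ i, {x | c i < u x} := fun x hx =>
    Set.mem_iUnion.2 (htend.eventually_lt_const hx).exists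
  refine (measure_mono hsub).trans ?_
  have hmono : Monotone fun i => {x | c i < u x} := fun i j hij x hx => (hanti hij).trans_lt hx
  rw [hmono.measure_iUnion]
  exact iSup_le hmem

theorem rearr_le_add_rearr {u v : Ω → ℝ≥0∞} {b : ℝ≥0∞} (h : ∀ᵐ x ∂μ, u x ≤ b + v x) (s : ℝ) :
    rearr μ u s ≤ b + rearr μ v s := by
  refine sInf_le (le_trans (measure_mono_ae ?_) (measure_rearr_lt_le μ v s))
  filter_upwards [h] with x hx hlt
  by_contra hcon
  exact absurd (hx.trans (add_le_add_right (not_lt.1 hcon) b)) (not_le.2 hlt)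

theorem rearr_le_rearr_of_measure_le {u v : Ω → ℝ≥0∞}
    (h : ∀ τ, μ {x | τ < u x} ≤ μ {x | τ < v x}) (s : ℝ) : rearr μ u s ≤ rearr μ v s :=
  sInf_le_sInf fun τ hτ => (h τ).trans hτ

theorem rearr_mul_le_lintegral (μ : Measure Ω) (u : Ω → ℝ≥0∞) (t : ℝ) :
    rearr μ u t * ENNReal.ofReal t ≤ ∫⁻ s in Set.Ioo 0 t, rearr μ u s :=
  calc rearr μ u t * ENNReal.ofReal t
      = ∫⁻ _ in Set.Ioo 0 t, rearr μ u t := by simp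
    _ ≤ ∫⁻ s in Set.Ioo 0 t, rearr μ u s :=
        setLIntegral_mono' measurableSet_Ioo fun s hs => rearr_antitone μ u hs.2.le

/-- A step function whose values, listed in order, are dominated by the values of `u*` at the
corresponding points is dominated by `u` in distribution, however its values are arranged. -/
theorem measure_lt_sum_indicator_le {N : ℕ} [NeZero N] {E : Fin N → Set Ω}
    (hdisj : Pairwise (Function.onFun Disjoint E)) {d : ℝ}
    (hE : ∀ j, μ (E j) = ENNReal.ofReal d) {u : Ω → ℝ≥0∞} {c : Fin N → ℝ≥0}
    (hc : ∀ j, (c j : ℝ≥0∞) ≤ rearr μ u (((j : ℕ) + 1 : ℕ) * d)) (e : Fin N ≃ Fin N)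
    (τ : ℝ≥0∞) :
    μ {x | τ < ∑ j, (c (e j) : ℝ≥0∞) * (E j).indicator (fun _ => 1) x} ≤ μ {x | τ < u x} := by
  classical
  set S : Finset (Fin N) := Finset.univ.filter fun j => τ < c j with hS
  have hsub : {x | τ < ∑ j, (c (e j) : ℝ≥0∞) * (E j).indicator (fun _ => 1) x} ⊆
      ⋃ j ∈ S.map e.symm.toEmbedding, E j := by
    intro x hx
    have hx' : τ < ∑ j, (c (e j) : ℝ≥0∞) * (E j).indicator (fun _ => 1) x := hx
    by_cases hex : ∃ j, x ∈ E j
    · obtain ⟨j, hj⟩ := hex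
      have hother : ∀ i, i ≠ j → x ∉ E i := fun i hij hi =>
        Set.disjoint_left.1 (hdisj hij) hi hj
      rw [Finset.sum_eq_single j (fun i _ hij => by simp [hother i hij])
        (fun h => absurd (Finset.mem_univ j) h)] at hx'
      simp only [hj, Set.indicator_of_mem, mul_one] at hx'
      refine Set.mem_iUnion₂.2 ⟨j, ?_, hj⟩
      simp only [Finset.mem_map_equiv, Equiv.symm_symm, hS, Finset.mem_filter, Finset.mem_univ,
        true_and]
      exact hx'
    · push Not at hex
      simp [hex] at hx'
  refine (measure_mono hsub).trans ((measure_biUnion_finset_le _ _).trans ?_)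
  simp only [hE, Finset.sum_const, Finset.card_map, nsmul_eq_mul]
  rcases S.eq_empty_or_nonempty with h | h
  · simp [h]
  have hm : τ < c (S.max' h) := (Finset.mem_filter.1 (S.max'_mem h)).2
  -- Only the largest index in `S` matters, so `c` need not be monotone: at most `max S + 1` cells
  -- exceed `τ`, while `τ < u*((max S + 1) d)` says that `{u > τ}` has measure above `(max S + 1)
  -- d`.
  have hcard : S.card ≤ (S.max' h : ℕ) + 1 := by
    have : S ⊆ Finset.Iic (S.max' h) := fun j hj => Finset.mem_Iic.2 (S.le_max' j hj)
    simpa using Finset.card_le_card this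
  have hlt : ¬ μ {x | τ < u x} ≤ ENNReal.ofReal (((S.max' h : ℕ) + 1 : ℕ) * d) := fun hcon =>
    absurd (sInf_le hcon : rearr μ u _ ≤ τ) (not_le.2 (hm.trans_le (hc _)))
  refine le_trans ?_ (not_le.1 hlt).le
  rw [ENNReal.ofReal_mul (by positivity), ENNReal.ofReal_natCast]
  gcongr

/-- Since `u*` decreases, its left endpoint values bound it on each cell. Leaving out `(0, t / N)`
makes the sample points `t / N, 2t / N, …` those allowed in `measure_lt_sum_indicator_le`. -/
theorem lintegral_min_rearr_le (u : Ω → ℝ≥0∞) (M : ℝ≥0∞) {t : ℝ} (N : ℕ) [NeZero N] :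
    ∫⁻ s in Set.Ioo (t / N) t, min (rearr μ u s) M ≤
      ∑ j : Fin N, min (rearr μ u (((j : ℕ) + 1 : ℕ) * (t / N))) M * ENNReal.ofReal (t / N) := by
  have hN : (0 : ℝ) < N := by exact_mod_cast Nat.pos_of_ne_zero (NeZero.ne N)
  set I : Fin N → Set ℝ := fun j =>
    Set.Ico (((j : ℕ) + 1 : ℕ) * (t / N)) (((j : ℕ) + 1 : ℕ) * (t / N) + t / N) with hI
  have hsub : Set.Ioo (t / N) t ⊆ ⋃ j, I j := by
    intro s hs
    have hd : 0 < t / N := by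
      by_contra! hcon
      have ht : t ≤ 0 := by
        have : t = t / N * N := by field_simp
        rw [this]
        exact mul_nonpos_of_nonpos_of_nonneg hcon hN.le
      have : t ≤ t / N := by
        rw [le_div_iff₀ hN]
        have : (1 : ℝ) ≤ N := by exact_mod_cast Nat.pos_of_ne_zero (NeZero.ne N)
        nlinarith
      linarith [hs.1, hs.2]
    have hq : 1 ≤ s / (t / N) := (one_le_div hd).2 hs.1.le
    have hfl : 1 ≤ ⌊s / (t / N)⌋₊ := Nat.one_le_floor_iff _ |>.2 hq
    have h1 : (⌊s / (t / N)⌋₊ : ℝ) * (t / N) ≤ s :=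
      (le_div_iff₀ hd).1 (Nat.floor_le (by linarith))
    have h2 : s < ((⌊s / (t / N)⌋₊ : ℝ) + 1) * (t / N) :=
      (div_lt_iff₀ hd).1 (Nat.lt_floor_add_one _)
    have hlt : ⌊s / (t / N)⌋₊ < N + 1 := by
      have : (⌊s / (t / N)⌋₊ : ℝ) * (t / N) < N * (t / N) :=
        h1.trans_lt (hs.2.trans_eq (by field_simp))
      have := lt_of_mul_lt_mul_right this hd.le
      exact (by exact_mod_cast this : _ < N).trans (Nat.lt_succ_self N)
    -- The shift by one is there because cell `j` starts at `(j + 1) t / N`.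
    refine Set.mem_iUnion.2 ⟨⟨⌊s / (t / N)⌋₊ - 1, by omega⟩, ?_⟩
    simp only [hI, Nat.sub_add_cancel hfl]
    exact ⟨h1, by linarith⟩
  calc ∫⁻ s in Set.Ioo (t / N) t, min (rearr μ u s) M
      ≤ ∫⁻ s in ⋃ j, I j, min (rearr μ u s) M := lintegral_mono_set hsub
    _ ≤ ∑' j, ∫⁻ s in I j, min (rearr μ u s) M := lintegral_iUnion_le _ _
    _ = ∑ j, ∫⁻ s in I j, min (rearr μ u s) M := tsum_fintype _
    _ ≤ _ := by
      refine Finset.sum_le_sum fun j _ => ?_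
      calc ∫⁻ s in I j, min (rearr μ u s) M
          ≤ ∫⁻ _ in I j, min (rearr μ u (((j : ℕ) + 1 : ℕ) * (t / N))) M :=
            setLIntegral_mono' measurableSet_Ico fun s hs =>
              min_le_min_right _ (rearr_antitone μ u hs.1)
        _ = _ := by simp [hI]

end Rearrangement

/-! ### Rearrangement invariant spaces -/

namespace RISpace

variable {Ω : Type*} [MeasurableSpace Ω] {μ : Measure Ω} (X : RISpace μ)

theorem sum_le {ι : Type*} (s : Finset ι) {v : ι → Ω → ℝ≥0∞} (hv : ∀ i, AEMeasurable (v i) μ) :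
    X.ρ (fun x => ∑ i ∈ s, v i x) ≤ ∑ i ∈ s, X.ρ (v i) := by
  classical
  induction s using Finset.induction_on with
  | empty =>
    have : X.ρ (fun _ => 0) = 0 := (X.eq_zero_iff _ aemeasurable_const).2 Filter.EventuallyEq.rfl
    simp [this]
  | insert a s ha ih =>
    simp only [Finset.sum_insert ha]
    exact (X.add_le _ _ (hv a) (Finset.aemeasurable_fun_sum s fun i _ => hv i)).trans
      (by gcongr)

/-- Averaging over the cyclic rearrangements of a step function. -/
theorem sum_mul_fundamental_le {N : ℕ} [NeZero N] {E : Fin N → Set Ω}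
    (hEm : ∀ j, MeasurableSet (E j)) (hdisj : Pairwise (Function.onFun Disjoint E)) {d t : ℝ}
    (hE : ∀ j, μ (E j) = ENNReal.ofReal d) (hEt : μ (⋃ j, E j) = ENNReal.ofReal t)
    {u : Ω → ℝ≥0∞} (hu : AEMeasurable u μ) {c : Fin N → ℝ≥0}
    (hc : ∀ j, (c j : ℝ≥0∞) ≤ rearr μ u (((j : ℕ) + 1 : ℕ) * d)) :
    (∑ j, (c j : ℝ≥0∞)) * X.fundamental t ≤ N * X.ρ u := by
  set v : Fin N → Ω → ℝ≥0∞ := fun i x =>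
    ∑ j, (c (j + i) : ℝ≥0∞) * (E j).indicator (fun _ => 1) x with hv
  have hvm : ∀ i, AEMeasurable (v i) μ := fun i =>
    (Finset.measurable_fun_sum _ fun j _ =>
      (measurable_const.indicator (hEm j)).const_mul _).aemeasurable
  have hvle : ∀ i, X.ρ (v i) ≤ X.ρ u := fun i =>
    X.rearr_invariant _ _ (hvm i) hu (Filter.Eventually.of_forall
      (rearr_le_rearr_of_measure_le fun τ =>
        measure_lt_sum_indicator_le hdisj hE hc (Equiv.addRight i) τ))
  have hsum : (fun x => ∑ i, v i x) = fun x =>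
      ((∑ j, c j : ℝ≥0) : ℝ≥0∞) * (⋃ j, E j).indicator (fun _ => 1) x := by
    ext x
    have hind : (⋃ j, E j).indicator (fun _ => (1 : ℝ≥0∞)) x =
        ∑ j, (E j).indicator (fun _ => 1) x := by
      by_cases hex : ∃ j, x ∈ E j
      · obtain ⟨j, hj⟩ := hex
        have hother : ∀ i, i ≠ j → x ∉ E i := fun i hij hi =>
          Set.disjoint_left.1 (hdisj hij) hi hj
        rw [Finset.sum_eq_single j (fun i _ hij => by simp [hother i hij])
          (fun h => absurd (Finset.mem_univ j) h),
          Set.indicator_of_mem (Set.mem_iUnion.2 ⟨j, hj⟩), Set.indicator_of_mem hj]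
      · have hx : x ∉ ⋃ j, E j := by simpa using hex
        push Not at hex
        simp [hex]
    rw [hind, Finset.mul_sum, hv]
    dsimp only
    rw [Finset.sum_comm]
    refine Finset.sum_congr rfl fun j _ => ?_
    rw [← Finset.sum_mul]
    congr 1
    push_cast
    -- Over all the shifts, each cell receives every value `c i` exactly once.
    exact Equiv.sum_comp (Equiv.addLeft j) fun i => (c i : ℝ≥0∞)
  calc (∑ j, (c j : ℝ≥0∞)) * X.fundamental t
      = X.ρ fun x => ∑ i, v i x := by
        rw [hsum, X.smul_eq _ _ (measurable_const.indicator
          (MeasurableSet.iUnion hEm)).aemeasurable,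
          X.fundamental_eq (MeasurableSet.iUnion hEm) hEt]
        push_cast
        rfl
    _ ≤ ∑ i, X.ρ (v i) := X.sum_le _ hvm
    _ ≤ ∑ _i : Fin N, X.ρ u := Finset.sum_le_sum fun i _ => hvle i
    _ = N * X.ρ u := by simp

/-- The embedding of `X` into the Marcinkiewicz space with fundamental function `φ_X`. -/
theorem lintegral_rearr_mul_fundamental_le [MeasurableSpace.CountablySeparated Ω]
    (h0 : ∀ x, μ {x} = 0) {B : Set Ω} (hB : MeasurableSet B) (hBtop : μ B ≠ ∞) {t : ℝ}
    (ht0 : 0 < t) (ht : ENNReal.ofReal t < μ B) {u : Ω → ℝ≥0∞} (hu : AEMeasurable u μ) :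
    (∫⁻ s in Set.Ioo 0 t, rearr μ u s) * X.fundamental t ≤ ENNReal.ofReal t * X.ρ u := by
  have hmeas : Measurable (rearr μ u) := (rearr_antitone μ u).measurable
  -- Truncating at height `N` keeps the step values finite; the truncation and the omitted interval
  -- `(0, t / (N + 1))` disappear together by monotone convergence.
  have hstep : ∀ N : ℕ, (∫⁻ s in Set.Ioo (t / (N + 1 : ℕ)) t, min (rearr μ u s) N) *
      X.fundamental t ≤ ENNReal.ofReal t * X.ρ u := by
    intro N
    obtain ⟨E, hEm, hdisj, hE, hEt⟩ := exists_equipartition h0 hB hBtop ht0 ht (N + 1)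
    set c : Fin (N + 1) → ℝ≥0 := fun j =>
      (min (rearr μ u (((j : ℕ) + 1 : ℕ) * (t / (N + 1 : ℕ)))) N).toNNReal with hc
    have hcoe : ∀ j, (c j : ℝ≥0∞) = min (rearr μ u (((j : ℕ) + 1 : ℕ) * (t / (N + 1 : ℕ)))) N :=
      fun j => ENNReal.coe_toNNReal (ne_top_of_le_ne_top (ENNReal.natCast_ne_top N)
        (min_le_right _ _))
    have hsum := X.sum_mul_fundamental_le hEm hdisj hE hEt hu (c := c)
      (fun j => (hcoe j).trans_le (min_le_left _ _))
    calc (∫⁻ s in Set.Ioo (t / (N + 1 : ℕ)) t, min (rearr μ u s) N) * X.fundamental t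
        ≤ (∑ j, (c j : ℝ≥0∞) * ENNReal.ofReal (t / (N + 1 : ℕ))) * X.fundamental t := by
          refine mul_le_mul_left ((lintegral_min_rearr_le u N (N + 1)).trans_eq ?_) _
          simp only [hcoe]
      _ = ENNReal.ofReal (t / (N + 1 : ℕ)) * ((∑ j, (c j : ℝ≥0∞)) * X.fundamental t) := by
          rw [← Finset.sum_mul]
          ring
      _ ≤ ENNReal.ofReal (t / (N + 1 : ℕ)) * ((N + 1 : ℕ) * X.ρ u) := by gcongr
      _ = ENNReal.ofReal t * X.ρ u := by
          rw [← mul_assoc, ← ENNReal.ofReal_natCast, ← ENNReal.ofReal_mul (by positivity)]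
          congr 2
          field_simp
  set w : ℕ → ℝ → ℝ≥0∞ := fun N =>
    (Set.Ioo (t / (N + 1 : ℕ)) t).indicator fun s => min (rearr μ u s) N with hw
  have hle : ∫⁻ s in Set.Ioo 0 t, rearr μ u s ≤ ∫⁻ s, ⨆ N, w N s := by
    rw [← lintegral_indicator measurableSet_Ioo]
    refine lintegral_mono fun s => ?_
    by_cases hs : s ∈ Set.Ioo 0 t
    swap
    · simp [hs]
    rw [Set.indicator_of_mem hs]
    -- For `a < u*(s)`, an index above both `a` and `t / s` puts `s` in the interval and the
    -- truncation above `a`.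
    refine le_of_forall_lt fun a ha => ?_
    obtain ⟨N₁, hN₁⟩ := ENNReal.exists_nat_gt (ne_top_of_lt ha)
    obtain ⟨N₂, hN₂⟩ := exists_nat_gt (t / s)
    refine lt_of_lt_of_le ?_ (le_iSup _ (max N₁ N₂))
    have hmem : s ∈ Set.Ioo (t / (max N₁ N₂ + 1 : ℕ)) t := by
      refine ⟨?_, hs.2⟩
      rw [div_lt_iff₀ (by positivity)]
      rw [div_lt_iff₀ hs.1] at hN₂
      have : (N₂ : ℝ) ≤ (max N₁ N₂ + 1 : ℕ) := by
        exact_mod_cast (le_max_right N₁ N₂).trans (Nat.le_succ _)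
      nlinarith [hs.1]
    simp only [hw, Set.indicator_of_mem hmem]
    refine lt_min ha (hN₁.trans_le ?_)
    exact_mod_cast le_max_left N₁ N₂
  have hwmono : Monotone w := by
    intro N M hNM s
    have hNM' : (N : ℝ≥0∞) ≤ M := by exact_mod_cast hNM
    have hsub : Set.Ioo (t / (N + 1 : ℕ)) t ⊆ Set.Ioo (t / (M + 1 : ℕ)) t :=
      Set.Ioo_subset_Ioo_left (by gcongr)
    by_cases hs : s ∈ Set.Ioo (t / (N + 1 : ℕ)) t
    · simp only [hw, Set.indicator_of_mem hs, Set.indicator_of_mem (hsub hs)]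
      exact min_le_min_left _ hNM'
    · simp only [hw, Set.indicator_of_notMem hs]
      exact zero_le
  refine (mul_le_mul_left hle _).trans ?_
  rw [lintegral_iSup (fun N => (hmeas.min measurable_const).indicator measurableSet_Ioo) hwmono,
    ENNReal.iSup_mul]
  refine iSup_le fun N => ?_
  simp only [lintegral_indicator measurableSet_Ioo]
  exact hstep N

end RISpace

/-! ### Volume of balls in non-collapsing RD-spaces -/

section Main

variable {Ω : Type*} [MetricSpace Ω] [MeasurableSpace Ω] {μ : Measure Ω}

/-- Balls of radius `A R(t)` have measure larger than `2 t`. -/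
theorem IsRDSpace.exists_lt_measure_ball {k n : ℝ} (hΩ : IsRDSpace μ k n)
    (hnc : NonCollapsing μ) : ∃ A : ℝ, 1 ≤ A ∧ ∀ (x : Ω) (t : ℝ), 0 < t →
      ENNReal.ofReal (2 * t) < μ (Metric.ball x (A * max (t ^ (1 / n)) (t ^ (1 / k)))) := by
  obtain ⟨C₁, C₂, hC₁, hC₁1, hC₂, hgr⟩ := hΩ.growth
  obtain ⟨β, -, hβ0, hβ⟩ := ENNReal.lt_iff_exists_real_btwn.1 hnc
  have hβ0 : 0 < β := by simpa using hβ0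
  have hk := hΩ.k_pos
  have hn : 0 < n := hk.trans_le hΩ.k_le_n
  have hC₂0 : 0 < C₂ := by linarith
  have hunit : ∀ x, ENNReal.ofReal β ≤ μ (Metric.ball x 1) := fun x =>
    hβ.le.trans (iInf_le _ x)
  -- For `t ≥ 1`, enlarging the unit ball to radius `t^{1/k}` gains a factor `C₁ t`. For `t ≤ 1`,
  -- shrinking it to radius `t^{1/n}` keeps at least a fraction `t / C₂`.
  set c : ℝ := β * min C₁ (1 / C₂) with hc
  have hc0 : 0 < c := by positivity
  have hR : ∀ (x : Ω) (t : ℝ), 0 < t →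
      ENNReal.ofReal (c * t) ≤ μ (Metric.ball x (max (t ^ (1 / n)) (t ^ (1 / k)))) := by
    intro x t ht
    rcases le_total 1 t with h1 | h1
    · have hle : 1 ≤ t ^ (1 / k) := Real.one_le_rpow h1 (by positivity)
      have hpow : (t ^ (1 / k)) ^ k = t := by
        rw [← Real.rpow_mul ht.le, one_div_mul_cancel hk.ne', Real.rpow_one]
      have h := (hgr x 1 _ one_pos hle).1
      rw [hpow, mul_one] at h
      refine le_trans ?_ (h.trans (measure_mono (Metric.ball_subset_ball (le_max_right _ _))))
      refine le_trans ?_ (mul_le_mul_right (hunit x) _)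
      rw [← ENNReal.ofReal_mul (by positivity)]
      refine ENNReal.ofReal_le_ofReal ?_
      calc c * t ≤ (β * C₁) * t := by
            rw [hc]
            gcongr
            exact min_le_left _ _
        _ = C₁ * t * β := by ring
    · have hpos : 0 < t ^ (1 / n) := Real.rpow_pos_of_pos ht _
      have hle : 1 ≤ (t ^ (1 / n))⁻¹ :=
        (one_le_inv₀ hpos).2 (Real.rpow_le_one ht.le h1 (by positivity))
      have hpow : ((t ^ (1 / n))⁻¹) ^ n = t⁻¹ := by
        rw [Real.inv_rpow hpos.le, ← Real.rpow_mul ht.le, one_div_mul_cancel hn.ne',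
          Real.rpow_one]
      have h := (hgr x _ _ hpos hle).2
      rw [hpow, inv_mul_cancel₀ hpos.ne'] at h
      refine le_trans ?_ (measure_mono (Metric.ball_subset_ball (le_max_left _ _)))
      have h' := (hunit x).trans h
      calc ENNReal.ofReal (c * t) ≤ ENNReal.ofReal (t / C₂ * β) := by
            refine ENNReal.ofReal_le_ofReal ?_
            calc c * t ≤ (β * (1 / C₂)) * t := by
                  rw [hc]
                  gcongr
                  exact min_le_right _ _
              _ = t / C₂ * β := by ring
        _ = ENNReal.ofReal (t / C₂) * ENNReal.ofReal β := ENNReal.ofReal_mul (by positivity)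
        _ ≤ ENNReal.ofReal (t / C₂) * (ENNReal.ofReal (C₂ * t⁻¹) *
              μ (Metric.ball x (t ^ (1 / n)))) := by gcongr
        _ = μ (Metric.ball x (t ^ (1 / n))) := by
            rw [← mul_assoc, ← ENNReal.ofReal_mul (by positivity),
              show t / C₂ * (C₂ * t⁻¹) = 1 by field_simp, ENNReal.ofReal_one, one_mul]
  -- Dilation by `a^{1/k}` multiplies the measure by at least `C₁ a ≥ 3 / c`, which turns the bound
  -- `c t` into `3 t > 2 t`.
  set a : ℝ := max 1 (3 / (C₁ * c)) with ha
  have ha1 : 1 ≤ a := le_max_left _ _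
  refine ⟨a ^ (1 / k), Real.one_le_rpow ha1 (by positivity), fun x t ht => ?_⟩
  have hpow : (a ^ (1 / k)) ^ k = a := by
    rw [← Real.rpow_mul (by positivity), one_div_mul_cancel hk.ne', Real.rpow_one]
  have hRpos : 0 < max (t ^ (1 / n)) (t ^ (1 / k)) :=
    lt_max_of_lt_left (Real.rpow_pos_of_pos ht _)
  have h := (hgr x _ _ hRpos (Real.one_le_rpow ha1 (by positivity : 0 ≤ 1 / k))).1
  rw [hpow] at h
  refine lt_of_lt_of_le ?_ ((mul_le_mul_right (hR x t ht) _).trans h)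
  rw [← ENNReal.ofReal_mul (by positivity), ENNReal.ofReal_lt_ofReal_iff (by positivity)]
  have h3 : 3 ≤ C₁ * a * c := by
    have : 3 / (C₁ * c) ≤ a := le_max_right _ _
    rw [div_le_iff₀ (by positivity)] at this
    linarith
  nlinarith

/-! ### The oscillation estimate -/

/-- If every ball of radius `r` has measure larger than `2 t`, then the oscillation of `f₀ + f₁`
is controlled by the maximal function of `|f₀| + r g`, for any gradient `g` of `f₁`. -/
theorem oscillation_mul_le {f f₀ f₁ g : Ω → ℝ} {r t : ℝ} (hr : 0 ≤ r) (ht : 0 < t)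
    (hball : ∀ x : Ω, ENNReal.ofReal (2 * t) < μ (Metric.ball x r)) (hf : f =ᵐ[μ] f₀ + f₁)
    (hg : IsGradient μ f₁ g) :
    oscillation μ f t * ENNReal.ofReal t ≤
      2 * ∫⁻ s in Set.Ioo 0 t, rearr μ (fun x => ‖f₀ x‖ₑ + ENNReal.ofReal r * ‖g x‖ₑ) s := by
  set h : Ω → ℝ≥0∞ := fun x => ‖f₀ x‖ₑ + ENNReal.ofReal r * ‖g x‖ₑ with hh
  obtain ⟨-, hg0, N, hN0, hN⟩ := hg
  have hN' : ∀ᵐ x ∂μ, x ∉ N := measure_eq_zero_iff_ae_notMem.1 hN0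
  set M : Set Ω := {x | ¬ (x ∉ N ∧ f x = (f₀ + f₁) x)} with hM
  have hM' : μ M = 0 := ae_iff.1 (hN'.and hf)
  have hpt : ∀ᵐ x ∂μ, ‖f x‖ₑ ≤ (decRearr μ f t + rearr μ h t) + h x := by
    filter_upwards [hN', hf] with x hxN hxf
    -- This is where measure `2 t` is needed: the two superlevel sets have total measure at most `2
    -- t` and `M` is null.
    obtain ⟨y, hyB, hy⟩ : ∃ y ∈ Metric.ball x r,
        y ∉ {x | decRearr μ f t < ‖f x‖ₑ} ∪ {x | rearr μ h t < h x} ∪ M := by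
      by_contra! hcon
      refine absurd (hball x) (not_lt.2 ((measure_mono hcon).trans
        ((measure_union_le _ _).trans ?_)))
      rw [hM', add_zero, two_mul, ENNReal.ofReal_add ht.le ht.le]
      exact (measure_union_le _ _).trans
        (add_le_add (measure_rearr_lt_le μ _ t) (measure_rearr_lt_le μ h t))
    simp only [hM, Set.mem_union, Set.mem_ofPred_eq, not_or, not_lt, not_not] at hy
    obtain ⟨⟨hy1, hy2⟩, hyN, hyf⟩ := hy
    have hreal : ‖f x‖ ≤ ‖f y‖ + (‖f₀ y‖ + r * ‖g y‖) + (‖f₀ x‖ + r * ‖g x‖) := by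
      have h1 := hN x hxN y hyN
      have h2 : dist x y * (g x + g y) ≤ r * (g x + g y) := by
        refine mul_le_mul_of_nonneg_right ?_ (add_nonneg (hg0 x) (hg0 y))
        rw [dist_comm]
        exact (Metric.mem_ball.1 hyB).le
      rw [Pi.add_apply] at hxf hyf
      simp only [Real.norm_eq_abs, abs_of_nonneg (hg0 _)]
      have h3 : f x = f y + (f₀ x - f₀ y) + (f₁ x - f₁ y) := by rw [hxf, hyf]; ring
      have h4 := abs_add_le (f y + (f₀ x - f₀ y)) (f₁ x - f₁ y)
      have h5 := abs_add_le (f y) (f₀ x - f₀ y)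
      have h6 := abs_sub (f₀ x) (f₀ y)
      rw [h3]
      linarith
    have hen : ‖f x‖ₑ ≤ ‖f y‖ₑ + h y + h x := by
      have := ENNReal.ofReal_le_ofReal hreal
      rw [ENNReal.ofReal_add (by positivity) (by positivity),
        ENNReal.ofReal_add (by positivity) (by positivity),
        ENNReal.ofReal_add (by positivity) (by positivity),
        ENNReal.ofReal_add (by positivity) (by positivity),
        ENNReal.ofReal_mul hr, ENNReal.ofReal_mul hr] at this
      simpa only [ofReal_norm] using this
    exact hen.trans (by gcongr)
  have hrearr : ∀ s, decRearr μ f s ≤ (decRearr μ f t + rearr μ h t) + rearr μ h s :=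
    rearr_le_add_rearr hpt
  have ht' : ENNReal.ofReal t ≠ 0 := by simpa using ht
  have hint : ∫⁻ s in Set.Ioo 0 t, decRearr μ f s ≤
      decRearr μ f t * ENNReal.ofReal t + 2 * ∫⁻ s in Set.Ioo 0 t, rearr μ h s := by
    calc ∫⁻ s in Set.Ioo 0 t, decRearr μ f s
        ≤ ∫⁻ s in Set.Ioo 0 t, (decRearr μ f t + rearr μ h t) + rearr μ h s :=
          lintegral_mono hrearr
      _ = decRearr μ f t * ENNReal.ofReal t + (rearr μ h t * ENNReal.ofReal t +
            ∫⁻ s in Set.Ioo 0 t, rearr μ h s) := by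
          rw [lintegral_add_left measurable_const]
          simp [add_mul, add_assoc]
      _ ≤ _ := by
          rw [two_mul]
          gcongr
          exact rearr_mul_le_lintegral μ h t
  have hosc : oscillation μ f t ≤
      (2 * ∫⁻ s in Set.Ioo 0 t, rearr μ h s) / ENNReal.ofReal t := by
    refine tsub_le_iff_left.2 ((ENNReal.div_le_div_right hint _).trans_eq ?_)
    rw [ENNReal.add_div, ENNReal.mul_div_cancel_right ht' ENNReal.ofReal_ne_top]
  exact ENNReal.mul_le_of_le_div hosc

theorem oscillation_mul_fundamental_le [BorelSpace Ω] {k n : ℝ} (hΩ : IsRDSpace μ k n) (X : RISpace μ)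
    {f f₀ f₁ g : Ω → ℝ} {A R t : ℝ} (hA : 1 ≤ A) (ht : 0 < t)
    (hball : ∀ x : Ω, ENNReal.ofReal (2 * t) < μ (Metric.ball x (A * R)))
    (hf : f =ᵐ[μ] f₀ + f₁) (hf₀ : AEMeasurable f₀ μ) (hg : IsGradient μ f₁ g) :
    oscillation μ f t * X.fundamental t ≤
      2 * ENNReal.ofReal A * (X.norm f₀ + ENNReal.ofReal R * X.norm g) := by
  rcases isEmpty_or_nonempty Ω with hE | ⟨⟨x₀⟩⟩
  · have : decRearr μ f = fun _ => 0 := by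
      ext s
      exact le_antisymm (sInf_le (by simp [Set.eq_empty_of_isEmpty])) zero_le
    simp [oscillation, maxRearr, this]
  have := hΩ.toIsMetricMeasure.secondCountableTopology
  have ht' : ENNReal.ofReal t ≠ 0 := by simpa using ht
  have hAR : 0 < A * R := by
    by_contra! hcon
    have := hball x₀
    rw [Metric.ball_eq_empty.2 hcon] at this
    simp at this
  set h : Ω → ℝ≥0∞ := fun x => ‖f₀ x‖ₑ + ENNReal.ofReal (A * R) * ‖g x‖ₑ with hh
  have hgm : AEMeasurable (fun x => ‖g x‖ₑ) μ := hg.1.enorm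
  have hhm : AEMeasurable h μ := hf₀.enorm.add (hgm.const_mul _)
  have h1 := oscillation_mul_le hAR.le ht hball hf hg
  -- Any ball of radius `A R` serves as the ambient set of finite measure above `t`.
  have h2 := X.lintegral_rearr_mul_fundamental_le hΩ.singleton_eq_zero
    Metric.isOpen_ball.measurableSet (hΩ.ball_lt_top x₀ _ hAR).ne ht
    ((ENNReal.ofReal_le_ofReal (by linarith)).trans_lt (hball x₀)) hhm
  have h3 : X.ρ h ≤ ENNReal.ofReal A * (X.norm f₀ + ENNReal.ofReal R * X.norm g) := by
    have hA' : 1 ≤ ENNReal.ofReal A := ENNReal.one_le_ofReal.2 hA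
    calc X.ρ h ≤ X.norm f₀ + ENNReal.ofReal (A * R) * X.norm g :=
          (X.add_le _ _ hf₀.enorm (hgm.const_mul _)).trans_eq
            (congrArg (X.norm f₀ + ·) (X.smul_eq (A * R).toNNReal _ hgm))
      _ ≤ ENNReal.ofReal A * X.norm f₀ + ENNReal.ofReal (A * R) * X.norm g := by
          gcongr
          exact le_mul_of_one_le_left zero_le hA'
      _ = _ := by
          rw [ENNReal.ofReal_mul (by linarith)]
          ring
  refine (ENNReal.mul_le_mul_iff_right ht' ENNReal.ofReal_ne_top).1 ?_
  calc ENNReal.ofReal t * (oscillation μ f t * X.fundamental t)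
      = (oscillation μ f t * ENNReal.ofReal t) * X.fundamental t := by ring
    _ ≤ (2 * ∫⁻ s in Set.Ioo 0 t, rearr μ h s) * X.fundamental t := by gcongr
    _ = 2 * ((∫⁻ s in Set.Ioo 0 t, rearr μ h s) * X.fundamental t) := by ring
    _ ≤ 2 * (ENNReal.ofReal t *
          (ENNReal.ofReal A * (X.norm f₀ + ENNReal.ofReal R * X.norm g))) := by
        exact mul_le_mul_right (h2.trans (mul_le_mul_right h3 _)) _
    _ = _ := by ring

/-- This permits division by `φ_X(t)`. A set of measure exactly `t` exists inside the ball, so the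
infimum defining `φ_X(t)` is not over an empty family. -/
theorem RISpace.fundamental_ne_zero_ne_top [BorelSpace Ω] {k n : ℝ} (hΩ : IsRDSpace μ k n)
    (X : RISpace μ) {t : ℝ} (ht : 0 < t)
    (hball : ∃ (x : Ω) (r : ℝ), ENNReal.ofReal t < μ (Metric.ball x r)) :
    X.fundamental t ≠ 0 ∧ X.fundamental t ≠ ∞ := by
  have := hΩ.toIsMetricMeasure.secondCountableTopology
  obtain ⟨x, r, hr⟩ := hball
  have hr0 : 0 < r := by
    by_contra! hcon
    rw [Metric.ball_eq_empty.2 hcon] at hr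
    simp at hr
  obtain ⟨F, hFm, -, hF⟩ := exists_monotoneOn_measure_eq hΩ.singleton_eq_zero
    Metric.isOpen_ball.measurableSet (hΩ.ball_lt_top x r hr0).ne hr
  have hFt := hF t (Set.right_mem_Icc.2 ht.le)
  rw [X.fundamental_eq (hFm t) hFt]
  refine ⟨fun h => ?_, (X.indicator_lt_top _ (hFm t)
    (hFt.trans_lt ENNReal.ofReal_lt_top)).ne⟩
  rw [X.eq_zero_iff _ (measurable_const.indicator (hFm t)).aemeasurable] at h
  rw [Set.indicator_ae_eq_zero] at h
  have hsupp : (Function.support fun _ : Ω => (1 : ℝ≥0∞)) = Set.univ := by ext; simp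
  rw [hsupp, Set.inter_univ, hFt, ENNReal.ofReal_eq_zero] at h
  linarith

theorem oscillation_mul_fundamental_le_peetreK [BorelSpace Ω] {k n : ℝ}
    (hΩ : IsRDSpace μ k n) (X : RISpace μ) (f : Ω → ℝ) {A R t : ℝ} (hA : 1 ≤ A) (hR : 0 < R) (ht : 0 < t)
    (hball : ∀ x : Ω, ENNReal.ofReal (2 * t) < μ (Metric.ball x (A * R))) :
    oscillation μ f t * X.fundamental t ≤ 2 * ENNReal.ofReal A * peetreK X f R := by
  have hA0 : 2 * ENNReal.ofReal A ≠ 0 := by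
    simpa using (by linarith : 0 < A)
  have hAtop : 2 * ENNReal.ofReal A ≠ ∞ := ENNReal.mul_ne_top (by simp) ENNReal.ofReal_ne_top
  have hR0 : ENNReal.ofReal R ≠ 0 := by simpa using hR
  -- Constants and the `f₀` term are moved to the left so that each infimum, first over
  -- decompositions and then over gradients, stands alone on the right.
  rw [mul_comm (2 * _), ← ENNReal.div_le_iff hA0 hAtop]
  refine le_iInf fun f₀ => le_iInf fun f₁ => le_iInf fun hf₀ => le_iInf fun _ =>
    le_iInf fun hf => ?_
  rw [← tsub_le_iff_left, mul_comm (ENNReal.ofReal R), ← ENNReal.div_le_iff hR0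
    ENNReal.ofReal_ne_top]
  refine le_iInf fun g => le_iInf fun hg => ?_
  rw [ENNReal.div_le_iff hR0 ENNReal.ofReal_ne_top, mul_comm (X.norm g), tsub_le_iff_left,
    ENNReal.div_le_iff hA0 hAtop, mul_comm _ (2 * _)]
  exact oscillation_mul_fundamental_le hΩ X hA ht hball hf hf₀.1 hg

end Main

end HajlaszBesov

end

/-- On a non-collapsing RD-space with indices `(k, n)`, `O(f, t) ≤ C K(f, R(t)) / φ_X(t)` with
`R(t) = max (t^{1/n}, t^{1/k})`. -/
theorem mainTheorem5 {Ω : Type*} [MetricSpace Ω] [MeasurableSpace Ω] [BorelSpace Ω]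
    (μ : Measure Ω) (k n : ℝ) (hΩ : HajlaszBesov.IsRDSpace μ k n)
    (hnc : HajlaszBesov.NonCollapsing μ) :
    ∃ C : ℝ≥0, ∀ (X : HajlaszBesov.RISpace μ) (f : Ω → ℝ),
      HajlaszBesov.MemHajlasz μ (HajlaszBesov.sumNorm μ) f →
      ∀ t : ℝ, 0 < t →
        HajlaszBesov.oscillation μ f t ≤
          C * (HajlaszBesov.peetreK X f (max (t ^ (1 / n)) (t ^ (1 / k))) / X.fundamental t) := by
  obtain ⟨A, hA, hball⟩ := hΩ.exists_lt_measure_ball hnc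
  -- The factor `2` comes from `h*(t) + h**(t) ≤ 2 h**(t)`, and `A` from the radius `A R(t)`.
  refine ⟨2 * A.toNNReal, fun X f _ t ht => ?_⟩
  have hR : 0 < max (t ^ (1 / n)) (t ^ (1 / k)) := lt_max_of_lt_left (Real.rpow_pos_of_pos ht _)
  rcases isEmpty_or_nonempty Ω with hE | hne
  · have : HajlaszBesov.decRearr μ f = fun _ => 0 := by
      ext s
      exact le_antisymm (sInf_le (by simp [Set.eq_empty_of_isEmpty])) zero_le
    simp [HajlaszBesov.oscillation, HajlaszBesov.maxRearr, this]
  obtain ⟨h0, htop⟩ := X.fundamental_ne_zero_ne_top hΩ ht ⟨hne.some, _,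
    (ENNReal.ofReal_le_ofReal (by linarith)).trans_lt (hball hne.some t ht)⟩
  have h := HajlaszBesov.oscillation_mul_fundamental_le_peetreK hΩ X f hA hR ht
    fun x => hball x t ht
  rw [← mul_div_assoc, ENNReal.le_div_iff_mul_le (Or.inl h0) (Or.inl htop)]
  simpa [ENNReal.ofReal] using h
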